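/- Let $\mathbb T=[0,2\pi]$ be the flat torus. For $f\in L^1((1+v^2)\,d\theta\,dv)$ on $\mathbb T\times\mathbb R$ put $\rho_f(\theta)=\int_{\mathbb R} f(\theta,v)\,dv$, $\phi_f(\theta)=-\int_0^{2\pi}\rho_f(\theta')\cos(\theta-\theta')\,d\theta'$, $M_f=\int_0^{2\pi}\rho_f(\theta)(\cos\theta,\sin\theta)\,d\theta\in\mathbb R^2$ and $$\mathcal H(f)=\frac12\iint v^2 f\,d\theta\,dv+\frac12\int_0^{2\pi}\rho_f\,\phi_f\,d\theta .$$ For nonnegative $f\in L^1(\mathbb T\times\mathbb R)$ put $\mu_f(t)=|\{(\theta,v)\in\mathbb T\times\mathbb R: f(\theta,v)>t\}|$ for $t\ge 0$, $f^\sharp(s)=\inf\{t\ge0:\mu_f(t)\le s\}$ for $s\ge 0$, and $f^*(\theta,v)=f^\sharp\big(|B(0,\sqrt{\theta^2+v^2})\cap(\mathbb T\times\mathbb R)|\big)$, where $B(0,R)$ is the open disc of radius $R$ in $\mathbb R^2$ and $|\cdot|$ is Lebesgue measure. For a continuous $\phi:\mathbb T\to\mathbb R$ put $a_\phi(e)=|\{(\theta,v)\in\mathbb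 T\times\mathbb R: v^2/2+\phi(\theta)<e\}|$ and $f^{*\phi}(\theta,v)=f^\sharp\big(a_\phi(v^2/2+\phi(\theta))\big)$. Let $m_0>0$, $e_*\in\mathbb R\cup\{+\infty\}$, and let $F:\mathbb R\to\mathbb R$ be continuous, of class $C^1$ with $F'<0$ on $(-\infty,e_*)$, with $F=0$ on $[e_*,+\infty)$ if $e_*<+\infty$ and $F(e)\to0$ as $e\to+\infty$ if $e_*=+\infty$. Assume that $f_0(\theta,v)=F(v^2/2-m_0\cos\theta)$ belongs to $L^1((1+v^2)\,d\theta\,dv)$ and that $\phi_{f_0}(\theta)=-m_0\cos\theta$ for all $\theta$. If $e_*=m_0$, assume moreover that $\int_{-m_0}^{m_0}\log(m_0-e)F'(e)\,de<+\infty$. For $m\ge0$ put $$\mathcal J(m)=\frac{m^2}{2}+\iint\Big(\frac{v^2}{2}+\phi(\theta)\Big)f_0^{*\phi}(\theta,v)\,d\theta\,dv,\qquad \phi(\theta)=-m\cos\theta .$$ Proposition. The integral defining $\mathcal J(m)$ converges absolutely for every $m\ge0$, and for every nonnegative $f\in L^1((1+v^2)\,d\theta\,dv)$ one has $f^*-f_0^*\in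 L^1(\mathbb T\times\mathbb R)$, $\int_0^{+\infty}s^2(f_0^\sharp(s)-f^\sharp(s))_+\,ds<+\infty$, and $$\mathcal J(|M_f|)-\mathcal J(|M_{f_0}|)\le \mathcal H(f)-\mathcal H(f_0)+\big(2m_0+3\|f\|_{L^1}\big)\|f^*-f_0^*\|_{L^1}+\int_0^{+\infty}s^2\big(f_0^\sharp(s)-f^\sharp(s)\big)_+\,ds .$$ -/

import Mathlib

open MeasureTheory Filter Topology
open scoped ENNReal NNReal

namespace HMF

noncomputable section

/-- The measure `dθ dv` on the phase space `𝕋 × ℝ`. The flat torus is represented by the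
interval `(0, 2π]` (equivalently `[0, 2π]`, the end point being negligible), and functions on
`𝕋 × ℝ` by functions on `ℝ × ℝ`, whose values off the strip are never used. -/
def phaseMeasure : Measure (ℝ × ℝ) :=
  (volume.restrict (Set.Ioc 0 (2 * Real.pi))).prod volume

/-- `f ∈ L¹((1 + v²) dθ dv)`. -/
def InEnergySpace (f : ℝ × ℝ → ℝ) : Prop :=
  Integrable (fun x : ℝ × ℝ => (1 + x.2 ^ 2) * f x) phaseMeasure

/-- The `L¹(𝕋 × ℝ)` norm. -/
def normL1 (f : ℝ × ℝ → ℝ) : ℝ :=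
  ∫ x, |f x| ∂phaseMeasure

/-- `ρ_f(θ) = ∫ f(θ, v) dv`. -/
def density (f : ℝ × ℝ → ℝ) (θ : ℝ) : ℝ :=
  ∫ v : ℝ, f (θ, v)

/-- `φ_f(θ) = -∫₀^{2π} ρ_f(θ') cos(θ - θ') dθ'`. -/
def potential (f : ℝ × ℝ → ℝ) (θ : ℝ) : ℝ :=
  -∫ θ' in (0 : ℝ)..(2 * Real.pi), density f θ' * Real.cos (θ - θ')

/-- `M_f = ∫₀^{2π} ρ_f(θ) (cos θ, sin θ) dθ`, a vector of the Euclidean plane. -/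
def magnetization (f : ℝ × ℝ → ℝ) : EuclideanSpace ℝ (Fin 2) :=
  !₂[∫ θ in (0 : ℝ)..(2 * Real.pi), density f θ * Real.cos θ,
     ∫ θ in (0 : ℝ)..(2 * Real.pi), density f θ * Real.sin θ]

/-- The nonlinear energy `H(f) = ½ ∬ v² f dθ dv + ½ ∫ ρ_f φ_f dθ`. -/
def energy (f : ℝ × ℝ → ℝ) : ℝ :=
  (1 / 2) * (∫ x, x.2 ^ 2 * f x ∂phaseMeasure)
    + (1 / 2) * ∫ θ in (0 : ℝ)..(2 * Real.pi), density f θ * potential f θ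

/-- The distribution function `μ_f(t) = |{(θ, v) ∈ 𝕋 × ℝ : f(θ, v) > t}|`, `t ≥ 0`. -/
def distribution (f : ℝ × ℝ → ℝ) (t : ℝ≥0) : ℝ≥0∞ :=
  phaseMeasure {x | (t : ℝ) < f x}

/-- The pseudo-inverse `f^♯(s) = inf {t ≥ 0 : μ_f(t) ≤ s}` for `s ∈ [0, ∞]`. The value `∞`
(infimum of the empty set) can occur only at `s = 0` when `f` is integrable. -/
def sharp (f : ℝ × ℝ → ℝ) (s : ℝ≥0∞) : ℝ≥0∞ :=
  ⨅ (t : ℝ≥0) (_ : distribution f t ≤ s), (t : ℝ≥0∞)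

/-- `f^♯` as a real function of a real variable `s > 0`. -/
def sharpReal (f : ℝ × ℝ → ℝ) (s : ℝ) : ℝ :=
  (sharp f (ENNReal.ofReal s)).toReal

/-- The rearrangement
`f^*(θ, v) = f^♯(|B(0, √(θ² + v²)) ∩ (𝕋 × ℝ)|)`, `B(0, R)` being an open disc of `ℝ²`. -/
def rearrangement (f : ℝ × ℝ → ℝ) (x : ℝ × ℝ) : ℝ :=
  (sharp f (phaseMeasure
    {y : ℝ × ℝ | Real.sqrt (y.1 ^ 2 + y.2 ^ 2) < Real.sqrt (x.1 ^ 2 + x.2 ^ 2)})).toReal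

/-- `a_φ(e) = |{(θ, v) ∈ 𝕋 × ℝ : v²/2 + φ(θ) < e}|`. -/
def sublevelVolume (φ : ℝ → ℝ) (e : ℝ) : ℝ≥0∞ :=
  phaseMeasure {x | x.2 ^ 2 / 2 + φ x.1 < e}

/-- The rearrangement with respect to the microscopic energy,
`f^{*φ}(θ, v) = f^♯(a_φ(v²/2 + φ(θ)))`. -/
def energyRearrangement (φ : ℝ → ℝ) (f : ℝ × ℝ → ℝ) (x : ℝ × ℝ) : ℝ :=
  (sharp f (sublevelVolume φ (x.2 ^ 2 / 2 + φ x.1))).toReal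

/-- The potential `θ ↦ -m cos θ`. -/
def cosPotential (m : ℝ) (θ : ℝ) : ℝ :=
  -m * Real.cos θ

/-- The integrand `(v²/2 + φ) f₀^{*φ}` with `φ = -m cos θ`. -/
def reducedIntegrand (f₀ : ℝ × ℝ → ℝ) (m : ℝ) (x : ℝ × ℝ) : ℝ :=
  (x.2 ^ 2 / 2 + cosPotential m x.1) * energyRearrangement (cosPotential m) f₀ x

/-- The reduced energy
`J(m) = m²/2 + ∬ (v²/2 + φ) f₀^{*φ} dθ dv` with `φ = -m cos θ`. -/
def reducedEnergy (f₀ : ℝ × ℝ → ℝ) (m : ℝ) : ℝ :=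
  m ^ 2 / 2 + ∫ x, reducedIntegrand f₀ m x ∂phaseMeasure

/-- `f₀(θ, v) = F(v²/2 - m₀ cos θ)`. -/
def steadyState (F : ℝ → ℝ) (m₀ : ℝ) (x : ℝ × ℝ) : ℝ :=
  F (x.2 ^ 2 / 2 + cosPotential m₀ x.1)

/-- The standing assumptions on the profile `F`, the cut-off energy `e_* ∈ ℝ ∪ {+∞}` and the
magnetization `m₀ > 0` of the steady state `f₀`. -/
structure IsSteadyProfile (F : ℝ → ℝ) (eStar : WithTop ℝ) (m₀ : ℝ) : Prop where
  m₀_pos : 0 < m₀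
  continuous : Continuous F
  contDiffOn : ContDiffOn ℝ 1 F {e : ℝ | (e : WithTop ℝ) < eStar}
  deriv_neg : ∀ e : ℝ, (e : WithTop ℝ) < eStar → deriv F e < 0
  eq_zero : ∀ e : ℝ, eStar ≤ (e : WithTop ℝ) → F e = 0
  tendsto_zero : eStar = ⊤ → Tendsto F atTop (𝓝 0)
  inEnergySpace : InEnergySpace (steadyState F m₀)
  /-- The potential generated by `f₀` is `-m₀ cos θ`. -/
  selfConsistent : ∀ θ : ℝ, potential (steadyState F m₀) θ = cosPotential m₀ θ
  /-- If `e_* = m₀`, then `∫_{-m₀}^{m₀} log(m₀ - e) F'(e) de < +∞`. As the integrand is bounded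
  below, this is integrability. -/
  log_integrable : eStar = (m₀ : WithTop ℝ) →
    IntegrableOn (fun e : ℝ => Real.log (m₀ - e) * deriv F e) (Set.Ioo (-m₀) m₀)

end

end HMF

/-! Write `h` for the microscopic energy in the field of `f` and `m = |M_f|`. Then `H(f) = m²/2 + ∬
h f` (`energy_eq`). By the bathtub principle, rearranging `f` along the sublevel sets of `h` can
only lower `∬ h f` (`integral_mul_rearrangement_le`). Replacing `f^♯` by `f₀^♯` in the rearranged
integral turns the right side into `J(m)`, since a rotation in `θ` carries the field of `f` to `-m
cos θ` (`integral_rotate`). At `f₀` itself, a nonincreasing function of its own energy, the bathtub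
inequality reverses, so `H(f₀) ≤ J(|M_{f₀}|)`.

It remains to pay for the replacement. Let the rank of a point be the volume of the sublevel set of
`h` below it. The rank pushes phase volume forward to Lebesgue measure on the half-line
(`measurePreserving`), so every rearrangement is `f^♯` composed with a rank and its integrals become
one-dimensional. Since `-m ≤ h ≤ m + rank²` (`hamiltonian_le_rank`), the cost is at most `m ∫ |f^♯ -
f₀^♯| + ∫ s² (f₀^♯ - f^♯)₊ ds`, and `m ≤ ‖f‖_{L¹}`. -/

namespace HMF

noncomputable section

/-! ### Ranking a measure space by a real function -/

/-- A measurable function with sublevel sets of finite measure and null level sets, on a space of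
infinite measure. -/
structure IsLevelFunction {X : Type*} [MeasurableSpace X] (μ : Measure X) (g : X → ℝ) : Prop where
  measurable : Measurable g
  sublevel_ne_top : ∀ e, μ {x | g x < e} ≠ ∞
  level_null : ∀ e, μ {x | g x = e} = 0
  measure_univ : μ Set.univ = ∞

/-- The measure of the sublevel set of `g` below `x`. -/
def levelRank {X : Type*} [MeasurableSpace X] (μ : Measure X) (g : X → ℝ) (x : X) : ℝ :=
  (μ {y | g y < g x}).toReal

section LevelRank

variable {X : Type*} [MeasurableSpace X] {μ : Measure X} {g : X → ℝ}

lemma sublevel_mono {e e' : ℝ} (h : e ≤ e') : μ {x | g x < e} ≤ μ {x | g x < e'} :=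
  measure_mono fun _ hx => lt_of_lt_of_le hx h

lemma IsLevelFunction.ofReal_levelRank (hg : IsLevelFunction μ g) (x : X) :
    ENNReal.ofReal (levelRank μ g x) = μ {y | g y < g x} :=
  ENNReal.ofReal_toReal (hg.sublevel_ne_top _)

lemma levelRank_nonneg (x : X) : 0 ≤ levelRank μ g x := ENNReal.toReal_nonneg

lemma IsLevelFunction.levelRank_mono (hg : IsLevelFunction μ g) {x y : X} (h : g x ≤ g y) :
    levelRank μ g x ≤ levelRank μ g y :=
  ENNReal.toReal_mono (hg.sublevel_ne_top _) (sublevel_mono h)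

lemma IsLevelFunction.measurable_levelRank (hg : IsLevelFunction μ g) :
    Measurable (levelRank μ g) := by
  have h : Monotone fun e => μ {y | g y < e} := fun _ _ h => sublevel_mono h
  exact (h.measurable.comp hg.measurable).ennreal_toReal

/-- The volume of `{g < e}` is continuous in `e` because level sets are null, and it runs from `0`
to `∞`. The witness is the least level reaching `s`: continuity from below gives `≤`, continuity
from above gives `≥`. -/
lemma IsLevelFunction.exists_sublevel_eq (hg : IsLevelFunction μ g) {s : ℝ≥0∞} (hs : 0 < s)
    (hs' : s ≠ ∞) :
    ∃ c : ℝ, μ {x | g x < c} = s ∧ ∀ e < c, μ {x | g x < e} < s := by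
  set E : Set ℝ := {e | s ≤ μ {x | g x < e}} with hE
  have hne : E.Nonempty := by
    by_contra h
    have h1 : ∀ n : ℕ, μ {x | g x < n} ≤ s := fun n => by
      by_contra hn
      exact h ⟨n, (not_le.1 hn).le⟩
    have hu : (⋃ n : ℕ, {x | g x < n}) = Set.univ :=
      Set.eq_univ_of_forall fun x => Set.mem_iUnion.2 (exists_nat_gt (g x))
    have h2 : μ (⋃ n : ℕ, {x | g x < n}) ≤ s := by
      rw [Monotone.measure_iUnion]
      · exact iSup_le h1
      · intro m n hmn x (hx : g x < m)
        exact lt_of_lt_of_le hx (Nat.cast_le.2 hmn)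
    rw [hu, hg.measure_univ] at h2
    exact hs' (top_le_iff.1 h2)
  have hbdd : BddBelow E := by
    have h0 : Tendsto (fun n : ℕ => μ {x | g x < -(n : ℝ)}) atTop
        (𝓝 (μ (⋂ n : ℕ, {x | g x < -(n : ℝ)}))) := by
      refine tendsto_measure_iInter_atTop
        (fun n => (hg.measurable measurableSet_Iio).nullMeasurableSet) ?_
        ⟨0, hg.sublevel_ne_top _⟩
      intro m n hmn x (hx : g x < -(n : ℝ))
      exact lt_of_lt_of_le hx (neg_le_neg (Nat.cast_le.2 hmn))
    have he : (⋂ n : ℕ, {x | g x < -(n : ℝ)}) = ∅ := by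
      refine Set.eq_empty_of_forall_notMem fun x hx => ?_
      obtain ⟨n, hn⟩ := exists_nat_gt (-g x)
      have : g x < -(n : ℝ) := Set.mem_iInter.1 hx n
      linarith
    rw [he, measure_empty] at h0
    obtain ⟨n, hn⟩ := (h0.eventually (gt_mem_nhds hs)).exists
    refine ⟨-(n : ℝ), fun e he => ?_⟩
    by_contra hlt
    exact absurd (lt_of_le_of_lt (le_trans he (sublevel_mono (not_le.1 hlt).le)) hn) (lt_irrefl _)
  have hbelow : ∀ e < sInf E, μ {x | g x < e} < s := fun e he => by
    by_contra h
    exact absurd (csInf_le hbdd (not_lt.1 h)) (not_le.2 he)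
  refine ⟨sInf E, le_antisymm ?_ ?_, hbelow⟩
  · obtain ⟨u, hu, hlt, hlim⟩ := exists_seq_strictMono_tendsto (sInf E)
    have hU : {x | g x < sInf E} = ⋃ n, {x | g x < u n} := by
      ext x
      simp only [Set.mem_ofPred_eq, Set.mem_iUnion]
      exact ⟨fun h => (hlim.eventually (lt_mem_nhds h)).exists, fun ⟨n, hn⟩ => hn.trans (hlt n)⟩
    rw [hU, Monotone.measure_iUnion]
    · exact iSup_le fun n => (hbelow _ (hlt n)).le
    · intro m n hmn x hx
      exact lt_of_lt_of_le hx (hu.monotone hmn)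
  · have hI : Tendsto (fun e => μ {x | g x < e}) (𝓝[>] (sInf E))
        (𝓝 (μ (⋂ e > sInf E, {x | g x < e}))) := by
      refine tendsto_measure_biInter_gt (s := fun e => {x | g x < e})
        (fun e _ => (hg.measurable measurableSet_Iio).nullMeasurableSet) ?_
        ⟨sInf E + 1, by simp, hg.sublevel_ne_top _⟩
      intro i j _ hij x hx
      exact lt_of_lt_of_le hx hij
    have hS : (⋂ e > sInf E, {x | g x < e}) ⊆ {x | g x < sInf E} ∪ {x | g x = sInf E} := by
      intro x hx
      simp only [Set.mem_iInter, Set.mem_ofPred_eq] at hx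
      have : g x ≤ sInf E := le_of_forall_gt_imp_ge_of_dense fun e he => (hx e he).le
      exact this.lt_or_eq
    have h1 : s ≤ μ (⋂ e > sInf E, {x | g x < e}) := by
      refine ge_of_tendsto hI ?_
      filter_upwards [self_mem_nhdsWithin] with e he
      obtain ⟨e', he', hlt⟩ := exists_lt_of_csInf_lt hne he
      exact le_trans he' (sublevel_mono hlt.le)
    calc s ≤ _ := h1
      _ ≤ _ := measure_mono hS
      _ ≤ _ := measure_union_le _ _
      _ = _ := by rw [hg.level_null, add_zero]

/-- A sublevel set of the rank is the sublevel set of `g` at the least level whose volume is `s`. -/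
lemma IsLevelFunction.measure_levelRank_lt (hg : IsLevelFunction μ g) (s : ℝ) :
    μ {x | levelRank μ g x < s} = ENNReal.ofReal s := by
  rcases le_or_gt s 0 with hs | hs
  · have : {x | levelRank μ g x < s} = ∅ :=
      Set.eq_empty_of_forall_notMem fun x hx =>
        absurd (lt_of_lt_of_le hx hs) (not_lt.2 (levelRank_nonneg x))
    rw [this, measure_empty, ENNReal.ofReal_of_nonpos hs]
  · obtain ⟨c, hc, hlt⟩ := hg.exists_sublevel_eq (ENNReal.ofReal_pos.2 hs) ENNReal.ofReal_ne_top
    rw [← hc]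
    congr 1
    ext x
    rw [Set.mem_ofPred_eq, Set.mem_ofPred_eq, ← ENNReal.ofReal_lt_ofReal_iff hs, hg.ofReal_levelRank]
    refine ⟨fun h => ?_, fun h => hlt _ h⟩
    by_contra hn
    exact absurd (lt_of_le_of_lt (hc ▸ sublevel_mono (not_lt.1 hn)) h) (lt_irrefl _)

/-- The rank pushes the measure forward to Lebesgue measure on the half-line. -/
lemma IsLevelFunction.measurePreserving (hg : IsLevelFunction μ g) :
    MeasurePreserving (levelRank μ g) μ (volume.restrict (Set.Ioi 0)) := by
  refine ⟨hg.measurable_levelRank, ?_⟩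
  have hr : ∀ s : ℝ, (volume.restrict (Set.Ioi (0 : ℝ))) (Set.Iio s) = ENNReal.ofReal s := by
    intro s
    rw [Measure.restrict_apply measurableSet_Iio, Set.inter_comm, Set.Ioi_inter_Iio,
      Real.volume_Ioo, sub_zero]
  have hm : ∀ s : ℝ, (μ.map (levelRank μ g)) (Set.Iio s) = ENNReal.ofReal s := fun s => by
    rw [Measure.map_apply hg.measurable_levelRank measurableSet_Iio]
    exact hg.measure_levelRank_lt s
  symm
  refine Measure.ext_of_Ico _ _ fun a b hab => ?_
  have hI : Set.Ico a b = Set.Iio b \ Set.Iio a := by ext; simp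
  have hsub : Set.Iio a ⊆ Set.Iio b := Set.Iio_subset_Iio hab.le
  rw [hI, measure_sdiff hsub measurableSet_Iio.nullMeasurableSet (by simp [hr]),
    measure_sdiff hsub measurableSet_Iio.nullMeasurableSet (by simp [hm]), hr, hr, hm, hm]

/-- Rank `0` must be discarded: there `f^♯` may be infinite, and its real version then takes the
default value `0`. -/
lemma IsLevelFunction.ae_levelRank_pos (hg : IsLevelFunction μ g) :
    ∀ᵐ x ∂μ, 0 < levelRank μ g x :=
  hg.measurePreserving.quasiMeasurePreserving.ae (ae_restrict_mem measurableSet_Ioi)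

/-- Bathtub principle. -/
lemma setLIntegral_le_of_measure_eq {S S' : Set X} (hS : MeasurableSet S)
    (hS' : NullMeasurableSet S' μ) (hμ : μ S = μ S') (hfin : μ S ≠ ∞) {w : X → ℝ≥0∞}
    (hw : ∀ x ∈ S, ∀ y ∉ S, w x ≤ w y) : ∫⁻ x in S, w x ∂μ ≤ ∫⁻ x in S', w x ∂μ := by
  have hT := hS'.toMeasurable_ae_eq
  rw [← measure_congr hT] at hμ
  rw [← setLIntegral_congr hT]
  set T := toMeasurable μ S'
  have hTm : MeasurableSet T := measurableSet_toMeasurable μ S'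
  rw [← lintegral_inter_add_sdiff w S hTm, ← lintegral_inter_add_sdiff w T hS, Set.inter_comm]
  gcongr 1
  -- Outside the common part the two sets have equal mass, and the supremum of `w` over `S`
  -- separates the values of `w` on them.
  have hd : μ (S \ T) = μ (T \ S) := by
    have h1 := measure_inter_add_sdiff (μ := μ) S hTm
    have h2 := measure_inter_add_sdiff (μ := μ) T hS
    rw [Set.inter_comm, ← hμ, ← h1] at h2
    exact ((ENNReal.add_right_inj
      (ne_top_of_le_ne_top hfin (measure_mono Set.inter_subset_left))).1 h2).symm
  calc ∫⁻ x in S \ T, w x ∂μ ≤ ∫⁻ _ in S \ T, (⨆ x ∈ S, w x) ∂μ :=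
        setLIntegral_mono' (hS.diff hTm) fun x hx => le_iSup₂ (f := fun x _ => w x) x hx.1
    _ = ∫⁻ _ in T \ S, (⨆ x ∈ S, w x) ∂μ := by rw [setLIntegral_const, setLIntegral_const, hd]
    _ ≤ ∫⁻ x in T \ S, w x ∂μ :=
        setLIntegral_mono' (hTm.diff hS) fun y hy => iSup₂_le fun x hx => hw x hx y hy.2

/-- Comparison of two integrals through the superlevel sets of the integrands. -/
lemma lintegral_mul_le_of_setLIntegral_le {w : X → ℝ≥0∞} (hw : Measurable w) {h₁ h₂ : X → ℝ}
    (hm₁ : AEMeasurable h₁ μ) (hm₂ : AEMeasurable h₂ μ) (hn₁ : 0 ≤ᵐ[μ] h₁) (hn₂ : 0 ≤ᵐ[μ] h₂)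
    (h : ∀ t : ℝ, 0 < t → ∫⁻ x in {x | t < h₁ x}, w x ∂μ ≤ ∫⁻ x in {x | t < h₂ x}, w x ∂μ) :
    ∫⁻ x, w x * ENNReal.ofReal (h₁ x) ∂μ ≤ ∫⁻ x, w x * ENNReal.ofReal (h₂ x) ∂μ := by
  have hac : μ.withDensity w ≪ μ := withDensity_absolutelyContinuous μ w
  -- Layer-cake formula for the measure with density `w`.
  have key : ∀ h : X → ℝ, AEMeasurable h μ → 0 ≤ᵐ[μ] h →
      ∫⁻ x, w x * ENNReal.ofReal (h x) ∂μ
        = ∫⁻ t in Set.Ioi 0, ∫⁻ x in {x | t < h x}, w x ∂μ := by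
    intro h hm hn
    have h1 := lintegral_withDensity_eq_lintegral_mul₀ hw.aemeasurable hm.ennreal_ofReal
    simp only [Pi.mul_apply] at h1
    rw [← h1, lintegral_eq_lintegral_meas_lt _ (hac.ae_le hn) (hm.mono_ac hac)]
    refine lintegral_congr fun t => ?_
    exact withDensity_apply₀ w (nullMeasurableSet_lt aemeasurable_const hm)
  rw [key h₁ hm₁ hn₁, key h₂ hm₂ hn₂]
  exact setLIntegral_mono' measurableSet_Ioi fun t ht => h t ht

end LevelRank

/-! ### The pseudo-inverse of the distribution function -/

lemma sharp_antitone (f : ℝ × ℝ → ℝ) : Antitone (sharp f) := fun _ _ h =>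
  le_iInf₂ fun t ht => iInf₂_le t (ht.trans h)

lemma measurable_sharpReal (f : ℝ × ℝ → ℝ) : Measurable (sharpReal f) :=
  ((sharp_antitone f).measurable.comp ENNReal.measurable_ofReal).ennreal_toReal

lemma sharpReal_nonneg (f : ℝ × ℝ → ℝ) (s : ℝ) : 0 ≤ sharpReal f s := ENNReal.toReal_nonneg

lemma distribution_antitone (f : ℝ × ℝ → ℝ) : Antitone (distribution f) := fun _ _ h =>
  measure_mono fun _ hx => lt_of_le_of_lt (NNReal.coe_le_coe.2 h) hx

/-- The Galois connection behind the pseudo-inverse. The forward direction is the right continuity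
of `μ_f`: the infimum is attained. -/
lemma sharp_le_iff (f : ℝ × ℝ → ℝ) (s : ℝ≥0∞) (t : ℝ≥0) :
    sharp f s ≤ t ↔ distribution f t ≤ s := by
  refine ⟨fun h => ?_, fun h => iInf₂_le t h⟩
  have h1 : ∀ n : ℕ, distribution f (t + (n + 1 : ℝ≥0)⁻¹) ≤ s := fun n => by
    have hlt : sharp f s < ((t + (n + 1 : ℝ≥0)⁻¹ : ℝ≥0) : ℝ≥0∞) :=
      lt_of_le_of_lt h (ENNReal.coe_lt_coe.2 (lt_add_of_pos_right t (by positivity)))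
    obtain ⟨r, hr⟩ := iInf_lt_iff.1 hlt
    obtain ⟨hr1, hr2⟩ := iInf_lt_iff.1 hr
    exact (distribution_antitone f (ENNReal.coe_lt_coe.1 hr2).le).trans hr1
  have hU : {x | (t : ℝ) < f x} = ⋃ n : ℕ, {x | ((t + (n + 1 : ℝ≥0)⁻¹ : ℝ≥0) : ℝ) < f x} := by
    ext x
    simp only [Set.mem_ofPred_eq, Set.mem_iUnion, NNReal.coe_add, NNReal.coe_inv,
      NNReal.coe_natCast, NNReal.coe_one]
    refine ⟨fun h => ?_, fun ⟨n, hn⟩ => lt_trans (lt_add_of_pos_right _ (by positivity)) hn⟩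
    obtain ⟨n, hn⟩ := exists_nat_one_div_lt (sub_pos.2 h)
    exact ⟨n, by rw [one_div] at hn; linarith⟩
  unfold distribution
  rw [hU, Monotone.measure_iUnion]
  · exact iSup_le h1
  · intro m n hmn x hx
    refine lt_of_le_of_lt (NNReal.coe_le_coe.2 ?_) hx
    gcongr

lemma distribution_ne_top {f : ℝ × ℝ → ℝ} (hf : Integrable f phaseMeasure) {t : ℝ≥0}
    (ht : 0 < t) : distribution f t ≠ ∞ :=
  (hf.measure_gt_lt_top (NNReal.coe_pos.2 ht)).ne

/-- Integrability forces `μ_f(n) → 0`, so some finite `n` is admissible in the infimum. -/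
lemma sharp_ne_top {f : ℝ × ℝ → ℝ} (hf : Integrable f phaseMeasure) {s : ℝ≥0∞} (hs : 0 < s) :
    sharp f s ≠ ∞ := by
  have h0 : Tendsto (fun n : ℕ => distribution f n) atTop (𝓝 0) := by
    have h1 : Tendsto (fun n : ℕ => phaseMeasure {x | (n : ℝ) < f x}) atTop
        (𝓝 (phaseMeasure (⋂ n : ℕ, {x | (n : ℝ) < f x}))) := by
      refine tendsto_measure_iInter_atTop
        (fun n => nullMeasurableSet_lt aemeasurable_const hf.aemeasurable) ?_
        ⟨1, ?_⟩
      · intro m n hmn x (hx : (n : ℝ) < f x)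
        exact lt_of_le_of_lt (Nat.cast_le.2 hmn) hx
      · simpa [distribution] using distribution_ne_top hf one_pos
    have he : (⋂ n : ℕ, {x | (n : ℝ) < f x}) = ∅ := by
      refine Set.eq_empty_of_forall_notMem fun x hx => ?_
      obtain ⟨n, hn⟩ := exists_nat_gt (f x)
      exact absurd (Set.mem_iInter.1 hx n) (not_lt.2 hn.le)
    rw [he, measure_empty] at h1
    simpa [distribution] using h1
  obtain ⟨n, hn⟩ := (h0.eventually (gt_mem_nhds hs)).exists
  exact ne_top_of_le_ne_top ENNReal.coe_ne_top ((sharp_le_iff f s n).2 hn.le)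

lemma lt_sharpReal_iff {f : ℝ × ℝ → ℝ} (hf : Integrable f phaseMeasure) {s : ℝ} (hs : 0 < s)
    (t : ℝ≥0) : (t : ℝ) < sharpReal f s ↔ ENNReal.ofReal s < distribution f t := by
  rw [← not_le, ← not_le, ← sharp_le_iff, sharpReal]
  have := ENNReal.toReal_le_toReal (sharp_ne_top hf (ENNReal.ofReal_pos.2 hs))
    (ENNReal.coe_ne_top (r := t))
  rw [← this, ENNReal.coe_toReal]

/-! ### Rearrangement along a level function -/

section Rearrangement

variable {g : ℝ × ℝ → ℝ} {f : ℝ × ℝ → ℝ}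

/-- Superlevel sets of the rearrangement are sublevel sets of the rank, hence the optimal
competitors in the bathtub principle. -/
lemma IsLevelFunction.superlevel_ae_eq (hg : IsLevelFunction phaseMeasure g)
    (hf : Integrable f phaseMeasure) {t : ℝ≥0} (ht : 0 < t) :
    {x | (t : ℝ) < sharpReal f (levelRank phaseMeasure g x)} =ᵐ[phaseMeasure]
      {x | levelRank phaseMeasure g x < (distribution f t).toReal} := by
  filter_upwards [hg.ae_levelRank_pos] with x hx
  refine propext ?_
  change (t : ℝ) < sharpReal f (levelRank phaseMeasure g x) ↔
    levelRank phaseMeasure g x < (distribution f t).toReal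
  rw [lt_sharpReal_iff hf hx, ENNReal.ofReal_lt_iff_lt_toReal hx.le (distribution_ne_top hf ht)]

lemma IsLevelFunction.measure_rank_lt_distribution (hg : IsLevelFunction phaseMeasure g)
    (hf : Integrable f phaseMeasure) {t : ℝ≥0} (ht : 0 < t) :
    phaseMeasure {x | levelRank phaseMeasure g x < (distribution f t).toReal}
      = distribution f t := by
  rw [hg.measure_levelRank_lt, ENNReal.ofReal_toReal (distribution_ne_top hf ht)]

lemma IsLevelFunction.measurableSet_rank_lt (hg : IsLevelFunction phaseMeasure g) (s : ℝ) :
    MeasurableSet {x | levelRank phaseMeasure g x < s} :=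
  hg.measurable_levelRank measurableSet_Iio

lemma IsLevelFunction.measurable_rearrangement (hg : IsLevelFunction phaseMeasure g) :
    Measurable fun x => sharpReal f (levelRank phaseMeasure g x) :=
  (measurable_sharpReal f).comp hg.measurable_levelRank

/-- Rearranging along `g` decreases the integral against weights that increase with `g`. -/
lemma IsLevelFunction.lintegral_rearrangement_le (hg : IsLevelFunction phaseMeasure g)
    (hf : Integrable f phaseMeasure) (hf0 : 0 ≤ᵐ[phaseMeasure] f) {w : ℝ × ℝ → ℝ≥0∞}
    (hw : Measurable w) (hwg : ∀ x y, g x ≤ g y → w x ≤ w y) :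
    ∫⁻ x, w x * ENNReal.ofReal (sharpReal f (levelRank phaseMeasure g x)) ∂phaseMeasure
      ≤ ∫⁻ x, w x * ENNReal.ofReal (f x) ∂phaseMeasure := by
  refine lintegral_mul_le_of_setLIntegral_le hw hg.measurable_rearrangement.aemeasurable
    hf.aemeasurable (ae_of_all _ fun _ => sharpReal_nonneg _ _) hf0 fun t ht => ?_
  lift t to ℝ≥0 using ht.le
  have ht' : 0 < t := NNReal.coe_pos.1 ht
  rw [setLIntegral_congr (hg.superlevel_ae_eq hf ht')]
  refine setLIntegral_le_of_measure_eq (hg.measurableSet_rank_lt _)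
    (nullMeasurableSet_lt aemeasurable_const hf.aemeasurable)
    (hg.measure_rank_lt_distribution hf ht') ?_ ?_
  · rw [hg.measure_rank_lt_distribution hf ht']
    exact distribution_ne_top hf ht'
  · intro x hx y hy
    refine hwg x y (le_of_not_gt fun h => hy ?_)
    exact lt_of_le_of_lt (hg.levelRank_mono h.le) hx

/-- A nonincreasing function of `g` is, for weights that increase with `g`, at least as well placed
as its rearrangement along `g`. -/
lemma IsLevelFunction.lintegral_le_rearrangement (hg : IsLevelFunction phaseMeasure g)
    {F : ℝ → ℝ} (hF : Antitone F) (hF0 : ∀ e, 0 ≤ F e)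
    (hf : Integrable (fun x => F (g x)) phaseMeasure) {w : ℝ × ℝ → ℝ≥0∞}
    (hw : Measurable w) (hwg : ∀ x y, g x ≤ g y → w x ≤ w y) :
    ∫⁻ x, w x * ENNReal.ofReal (F (g x)) ∂phaseMeasure
      ≤ ∫⁻ x, w x * ENNReal.ofReal
          (sharpReal (fun x => F (g x)) (levelRank phaseMeasure g x)) ∂phaseMeasure := by
  refine lintegral_mul_le_of_setLIntegral_le hw hf.aemeasurable
    hg.measurable_rearrangement.aemeasurable (ae_of_all _ fun _ => hF0 _)
    (ae_of_all _ fun _ => sharpReal_nonneg _ _) fun t ht => ?_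
  lift t to ℝ≥0 using ht.le
  have ht' : 0 < t := NNReal.coe_pos.1 ht
  rw [setLIntegral_congr (hg.superlevel_ae_eq hf ht')]
  -- The superlevel sets of `F ∘ g` are themselves sublevel-type sets of `g`, so they now play the
  -- optimal role.
  refine setLIntegral_le_of_measure_eq
    (measurableSet_lt measurable_const (hF.measurable.comp hg.measurable))
    (hg.measurableSet_rank_lt _).nullMeasurableSet
    (hg.measure_rank_lt_distribution hf ht').symm (distribution_ne_top hf ht') ?_
  intro x hx y hy
  refine hwg x y (le_of_not_gt fun h => hy ?_)
  exact lt_of_lt_of_le hx (hF h.le)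

/-- Equimeasurability, integrated by the layer-cake formula. -/
lemma IsLevelFunction.lintegral_rearrangement (hg : IsLevelFunction phaseMeasure g)
    (hf : Integrable f phaseMeasure) (hf0 : 0 ≤ᵐ[phaseMeasure] f) :
    ∫⁻ x, ENNReal.ofReal (sharpReal f (levelRank phaseMeasure g x)) ∂phaseMeasure
      = ∫⁻ x, ENNReal.ofReal (f x) ∂phaseMeasure := by
  have hm := hg.measurable_rearrangement (f := f)
  rw [lintegral_eq_lintegral_meas_lt _ (ae_of_all _ fun _ => sharpReal_nonneg _ _) hm.aemeasurable,
    lintegral_eq_lintegral_meas_lt _ hf0 hf.aemeasurable]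
  refine setLIntegral_congr_fun measurableSet_Ioi fun t (ht : 0 < t) => ?_
  lift t to ℝ≥0 using ht.le
  have ht' : 0 < t := NNReal.coe_pos.1 ht
  exact (measure_congr (hg.superlevel_ae_eq hf ht')).trans (hg.measure_rank_lt_distribution hf ht')

lemma IsLevelFunction.integrable_rearrangement (hg : IsLevelFunction phaseMeasure g)
    (hf : Integrable f phaseMeasure) (hf0 : 0 ≤ᵐ[phaseMeasure] f) :
    Integrable (fun x => sharpReal f (levelRank phaseMeasure g x)) phaseMeasure := by
  rw [← lintegral_ofReal_ne_top_iff_integrable hg.measurable_rearrangement.aestronglyMeasurable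
    (ae_of_all _ fun _ => sharpReal_nonneg _ _), hg.lintegral_rearrangement hf hf0,
    lintegral_ofReal_ne_top_iff_integrable hf.aestronglyMeasurable hf0]
  exact hf

lemma IsLevelFunction.integral_rearrangement (hg : IsLevelFunction phaseMeasure g)
    (hf : Integrable f phaseMeasure) (hf0 : 0 ≤ᵐ[phaseMeasure] f) :
    ∫ x, sharpReal f (levelRank phaseMeasure g x) ∂phaseMeasure = ∫ x, f x ∂phaseMeasure := by
  rw [integral_eq_lintegral_of_nonneg_ae (ae_of_all _ fun _ => sharpReal_nonneg _ _)
    hg.measurable_rearrangement.aestronglyMeasurable,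
    integral_eq_lintegral_of_nonneg_ae hf0 hf.aestronglyMeasurable,
    hg.lintegral_rearrangement hf hf0]

lemma IsLevelFunction.integrable_comp_iff (hg : IsLevelFunction phaseMeasure g) {h : ℝ → ℝ}
    (hm : Measurable h) :
    Integrable (fun x => h (levelRank phaseMeasure g x)) phaseMeasure
      ↔ IntegrableOn h (Set.Ioi 0) :=
  hg.measurePreserving.integrable_comp hm.aestronglyMeasurable

lemma IsLevelFunction.integral_comp (hg : IsLevelFunction phaseMeasure g) {h : ℝ → ℝ}
    (hm : Measurable h) :
    ∫ x, h (levelRank phaseMeasure g x) ∂phaseMeasure = ∫ s in Set.Ioi (0 : ℝ), h s := by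
  rw [← hg.measurePreserving.map_eq, integral_map hg.measurable_levelRank.aemeasurable
    hm.aestronglyMeasurable]

/-- Real form of the bathtub inequality, for the weight `g` itself. -/
lemma IsLevelFunction.integral_mul_rearrangement_le (hg : IsLevelFunction phaseMeasure g)
    (hf : Integrable f phaseMeasure) (hf0 : 0 ≤ᵐ[phaseMeasure] f) {m : ℝ} (hm : ∀ x, -m ≤ g x)
    (hgf : Integrable (fun x => g x * f x) phaseMeasure)
    (hgr : Integrable (fun x => g x * sharpReal f (levelRank phaseMeasure g x)) phaseMeasure) :
    ∫ x, g x * sharpReal f (levelRank phaseMeasure g x) ∂phaseMeasure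
      ≤ ∫ x, g x * f x ∂phaseMeasure := by
  have hr := hg.integrable_rearrangement hf hf0
  have hpos : ∀ x, 0 ≤ g x + m := fun x => by linarith [hm x]
  -- The shift by `m` makes the weight nonnegative; its contribution `m ∫ f` is the same on both
  -- sides and cancels.
  have h1 : ∫ x, (g x + m) * sharpReal f (levelRank phaseMeasure g x) ∂phaseMeasure
      ≤ ∫ x, (g x + m) * f x ∂phaseMeasure := by
    have hi : Integrable (fun x => (g x + m) * f x) phaseMeasure := by
      simp only [add_mul]; exact hgf.add (hf.const_mul m)
    have hn : 0 ≤ᵐ[phaseMeasure] fun x => (g x + m) * f x := by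
      filter_upwards [hf0] with x hx using mul_nonneg (hpos x) hx
    rw [integral_eq_lintegral_of_nonneg_ae
      (ae_of_all _ fun x => mul_nonneg (hpos x) (sharpReal_nonneg _ _))
      ((hg.measurable.add_const m).mul hg.measurable_rearrangement).aestronglyMeasurable,
      integral_eq_lintegral_of_nonneg_ae hn hi.aestronglyMeasurable]
    refine ENNReal.toReal_mono
      ((lintegral_ofReal_ne_top_iff_integrable hi.aestronglyMeasurable hn).2 hi) ?_
    simp_rw [ENNReal.ofReal_mul (hpos _)]
    exact hg.lintegral_rearrangement_le hf hf0 (hg.measurable.add_const m).ennreal_ofReal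
      fun x y h => ENNReal.ofReal_le_ofReal (by linarith)
  simp only [add_mul] at h1
  rw [integral_add hgr (hr.const_mul m), integral_add hgf (hf.const_mul m), integral_const_mul,
    integral_const_mul, hg.integral_rearrangement hf hf0] at h1
  linarith

lemma IsLevelFunction.integral_mul_le_rearrangement (hg : IsLevelFunction phaseMeasure g)
    {F : ℝ → ℝ} (hF : Antitone F) (hF0 : ∀ e, 0 ≤ F e)
    (hf : Integrable (fun x => F (g x)) phaseMeasure) {m : ℝ} (hm : ∀ x, -m ≤ g x)
    (hgf : Integrable (fun x => g x * F (g x)) phaseMeasure)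
    (hgr : Integrable (fun x => g x *
      sharpReal (fun x => F (g x)) (levelRank phaseMeasure g x)) phaseMeasure) :
    ∫ x, g x * F (g x) ∂phaseMeasure
      ≤ ∫ x, g x * sharpReal (fun x => F (g x)) (levelRank phaseMeasure g x) ∂phaseMeasure := by
  have hf0 : 0 ≤ᵐ[phaseMeasure] fun x => F (g x) := ae_of_all _ fun x => hF0 _
  have hr := hg.integrable_rearrangement hf hf0
  have hpos : ∀ x, 0 ≤ g x + m := fun x => by linarith [hm x]
  have h1 : ∫ x, (g x + m) * F (g x) ∂phaseMeasure
      ≤ ∫ x, (g x + m) * sharpReal (fun x => F (g x)) (levelRank phaseMeasure g x)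
        ∂phaseMeasure := by
    have hi : Integrable (fun x => (g x + m) * sharpReal (fun x => F (g x))
        (levelRank phaseMeasure g x)) phaseMeasure := by
      simp only [add_mul]; exact hgr.add (hr.const_mul m)
    have hn : 0 ≤ᵐ[phaseMeasure] fun x => (g x + m) * sharpReal (fun x => F (g x))
        (levelRank phaseMeasure g x) :=
      ae_of_all _ fun x => mul_nonneg (hpos x) (sharpReal_nonneg _ _)
    rw [integral_eq_lintegral_of_nonneg_ae (ae_of_all _ fun x => mul_nonneg (hpos x) (hF0 _))
      ((hg.measurable.add_const m).mul (hF.measurable.comp hg.measurable)).aestronglyMeasurable,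
      integral_eq_lintegral_of_nonneg_ae hn hi.aestronglyMeasurable]
    refine ENNReal.toReal_mono
      ((lintegral_ofReal_ne_top_iff_integrable hi.aestronglyMeasurable hn).2 hi) ?_
    simp_rw [ENNReal.ofReal_mul (hpos _)]
    exact hg.lintegral_le_rearrangement hF hF0 hf (hg.measurable.add_const m).ennreal_ofReal
      fun x y h => ENNReal.ofReal_le_ofReal (by linarith)
  simp only [add_mul] at h1
  rw [integral_add hgr (hr.const_mul m), integral_add hgf (hf.const_mul m), integral_const_mul,
    integral_const_mul, hg.integral_rearrangement hf hf0] at h1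
  linarith

end Rearrangement

/-! ### Level functions on the phase space -/

instance : SFinite phaseMeasure := by unfold phaseMeasure; infer_instance

lemma phaseMeasure_abs_snd_lt (r : ℝ) :
    phaseMeasure {x : ℝ × ℝ | |x.2| < r} = ENNReal.ofReal (4 * Real.pi * r) := by
  have h : {x : ℝ × ℝ | |x.2| < r} = Set.univ ×ˢ Set.Ioo (-r) r := by
    ext x; simp [abs_lt]
  rw [h, phaseMeasure, Measure.prod_prod, Measure.restrict_apply_univ, Real.volume_Ioc,
    Real.volume_Ioo, ← ENNReal.ofReal_mul (by linarith [Real.pi_pos])]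
  congr 1
  ring

lemma phaseMeasure_univ : phaseMeasure Set.univ = ∞ := by
  rw [← Set.univ_prod_univ, phaseMeasure, Measure.prod_prod, Measure.restrict_apply_univ,
    Real.volume_Ioc, Real.volume_univ, ENNReal.mul_top]
  simp [Real.pi_pos]

lemma finite_sq_eq (c : ℝ) : {v : ℝ | v ^ 2 = c}.Finite := by
  refine Set.Finite.subset (Set.toFinite {Real.sqrt c, -Real.sqrt c}) fun v (hv : v ^ 2 = c) => ?_
  rw [← hv, Real.sqrt_sq_eq_abs]
  rcases abs_choice v with h | h <;> simp [h]

/-- A quadratic function of `v`, shifted by a function of `θ`, is a level function. -/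
lemma isLevelFunction_of_sq {g : ℝ × ℝ → ℝ} (hg : Measurable g)
    (hlt : ∀ e, ∃ r, ∀ x, g x < e → |x.2| < r)
    (heq : ∀ e θ, ∃ c, ∀ v, g (θ, v) = e → v ^ 2 = c) : IsLevelFunction phaseMeasure g where
  measurable := hg
  sublevel_ne_top e := by
    obtain ⟨r, hr⟩ := hlt e
    refine ne_top_of_le_ne_top ?_ (measure_mono (t := {x : ℝ × ℝ | |x.2| < r}) hr)
    rw [phaseMeasure_abs_snd_lt]
    exact ENNReal.ofReal_ne_top
  level_null e := by
    -- By Fubini it suffices that each slice at fixed `θ` contains at most two velocities.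
    refine (Measure.measure_prod_null (hg (measurableSet_singleton e))).2 (ae_of_all _ fun θ => ?_)
    obtain ⟨c, hc⟩ := heq e θ
    exact ((finite_sq_eq c).subset hc).measure_zero _
  measure_univ := phaseMeasure_univ

lemma isLevelFunction_radius :
    IsLevelFunction phaseMeasure fun x : ℝ × ℝ => Real.sqrt (x.1 ^ 2 + x.2 ^ 2) := by
  refine isLevelFunction_of_sq (by fun_prop) (fun e => ⟨e, fun x hx => ?_⟩)
    fun e θ => ⟨e ^ 2 - θ ^ 2, fun v hv => ?_⟩
  · refine lt_of_le_of_lt ?_ hx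
    rw [← Real.sqrt_sq_eq_abs]
    exact Real.sqrt_le_sqrt (by linarith [sq_nonneg x.1])
  · rw [← hv, Real.sq_sqrt (by positivity)]
    ring

/-- The microscopic energy in the field of magnetization `(a, b)`. -/
def hamiltonian (a b : ℝ) (x : ℝ × ℝ) : ℝ :=
  x.2 ^ 2 / 2 - (a * Real.cos x.1 + b * Real.sin x.1)

lemma abs_cos_add_sin_le (a b θ : ℝ) :
    |a * Real.cos θ + b * Real.sin θ| ≤ Real.sqrt (a ^ 2 + b ^ 2) := by
  refine Real.abs_le_sqrt ?_
  nlinarith [sq_nonneg (a * Real.sin θ - b * Real.cos θ), Real.sin_sq_add_cos_sq θ]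

lemma measurable_hamiltonian (a b : ℝ) : Measurable (hamiltonian a b) := by
  unfold hamiltonian; fun_prop

lemma neg_sqrt_le_hamiltonian (a b : ℝ) (x : ℝ × ℝ) :
    -Real.sqrt (a ^ 2 + b ^ 2) ≤ hamiltonian a b x := by
  have := (abs_le.1 (abs_cos_add_sin_le a b x.1)).2
  unfold hamiltonian
  nlinarith [sq_nonneg x.2]

lemma isLevelFunction_hamiltonian (a b : ℝ) :
    IsLevelFunction phaseMeasure (hamiltonian a b) := by
  refine isLevelFunction_of_sq (measurable_hamiltonian a b)
    (fun e => ⟨|e| + Real.sqrt (a ^ 2 + b ^ 2) + 1, fun x hx => ?_⟩)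
    fun e θ => ⟨2 * (e + (a * Real.cos θ + b * Real.sin θ)), fun v hv => ?_⟩
  · have h1 := (abs_le.1 (abs_cos_add_sin_le a b x.1)).2
    have h2 := le_abs_self e
    have h3 := Real.sqrt_nonneg (a ^ 2 + b ^ 2)
    have h4 := abs_nonneg e
    unfold hamiltonian at hx
    rw [← sq_abs] at hx
    nlinarith [sq_nonneg (|x.2| - 1)]
  · rw [← hv, hamiltonian]
    ring

/-- If the energy of `x` is `m + r²`, every point with `|v| < r` has smaller energy, so the rank is
at least `4πr ≥ r`. This is the source of the weight `s²`. -/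
lemma hamiltonian_le_rank (a b : ℝ) (x : ℝ × ℝ) :
    hamiltonian a b x
      ≤ Real.sqrt (a ^ 2 + b ^ 2) + levelRank phaseMeasure (hamiltonian a b) x ^ 2 := by
  set m := Real.sqrt (a ^ 2 + b ^ 2) with hm
  rcases le_or_gt (hamiltonian a b x) m with h | h
  · nlinarith [sq_nonneg (levelRank phaseMeasure (hamiltonian a b) x)]
  · set r := Real.sqrt (hamiltonian a b x - m) with hr
    have hr2 : r ^ 2 = hamiltonian a b x - m := Real.sq_sqrt (by linarith)
    have hr0 : 0 ≤ r := Real.sqrt_nonneg _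
    have hsub : phaseMeasure {y : ℝ × ℝ | |y.2| < r}
        ≤ phaseMeasure {y | hamiltonian a b y < hamiltonian a b x} := by
      refine measure_mono fun y (hy : |y.2| < r) => ?_
      have h1 := (abs_le.1 (abs_cos_add_sin_le a b y.1)).1
      have h2 : y.2 ^ 2 < r ^ 2 := sq_lt_sq' (abs_lt.1 hy).1 (abs_lt.1 hy).2
      change y.2 ^ 2 / 2 - (a * Real.cos y.1 + b * Real.sin y.1) < hamiltonian a b x
      nlinarith [sq_nonneg y.2]
    rw [phaseMeasure_abs_snd_lt, ← (isLevelFunction_hamiltonian a b).ofReal_levelRank,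
      ENNReal.ofReal_le_ofReal_iff (levelRank_nonneg x)] at hsub
    have : r ≤ levelRank phaseMeasure (hamiltonian a b) x := by
      nlinarith [Real.pi_gt_three]
    nlinarith

/-- Without a field the sublevel sets are strips; this lets the kinetic energy of `f` control the
second moment of `f^♯`. -/
lemma levelRank_kinetic_le (x : ℝ × ℝ) :
    levelRank phaseMeasure (hamiltonian 0 0) x ≤ 4 * Real.pi * |x.2| := by
  have h : {y | hamiltonian 0 0 y < hamiltonian 0 0 x} = {y : ℝ × ℝ | |y.2| < |x.2|} := by
    ext y
    change hamiltonian 0 0 y < hamiltonian 0 0 x ↔ |y.2| < |x.2|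
    rw [← sq_lt_sq, hamiltonian, hamiltonian]
    constructor <;> intro h <;> linarith
  rw [levelRank, h, phaseMeasure_abs_snd_lt, ENNReal.toReal_ofReal (by positivity)]

/-! ### Rotation invariance -/

lemma setLIntegral_periodic_sub {h : ℝ → ℝ≥0∞} (hp : Function.Periodic h (2 * Real.pi))
    (θ₀ : ℝ) :
    ∫⁻ θ in Set.Ioc 0 (2 * Real.pi), h (θ - θ₀) = ∫⁻ θ in Set.Ioc 0 (2 * Real.pi), h θ := by
  have h1 := (measurePreserving_sub_right (volume : Measure ℝ) θ₀).setLIntegral_comp_preimage_emb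
    (measurableEmbedding_subRight θ₀) h (Set.Ioc (-θ₀) (-θ₀ + 2 * Real.pi))
  have h2 : (fun θ => θ - θ₀) ⁻¹' Set.Ioc (-θ₀) (-θ₀ + 2 * Real.pi)
      = Set.Ioc 0 (2 * Real.pi) := by
    ext θ
    simp only [Set.mem_preimage, Set.mem_Ioc]
    constructor <;> rintro ⟨h, h'⟩ <;> constructor <;> linarith
  rw [h2] at h1
  rw [h1]
  have h3 := (isAddFundamentalDomain_Ioc Real.two_pi_pos 0).setLIntegral_eq
    (isAddFundamentalDomain_Ioc Real.two_pi_pos (-θ₀)) h ?_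
  · rw [zero_add] at h3
    exact h3.symm
  · rintro ⟨_, n, rfl⟩ x
    simpa [AddSubgroup.vadd_def, add_comm] using hp.int_mul n x

/-- With `θ₀` the argument of `(a, b)`, the field is `√(a² + b²) cos(θ - θ₀)`, and translation by
`θ₀` preserves the torus. -/
lemma map_hamiltonian_eq (a b : ℝ) :
    phaseMeasure.map (hamiltonian a b)
      = phaseMeasure.map (hamiltonian (Real.sqrt (a ^ 2 + b ^ 2)) 0) := by
  obtain ⟨θ₀, ha, hb⟩ : ∃ θ₀, Real.sqrt (a ^ 2 + b ^ 2) * Real.cos θ₀ = a ∧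
      Real.sqrt (a ^ 2 + b ^ 2) * Real.sin θ₀ = b := by
    refine ⟨Complex.arg ⟨a, b⟩, ?_⟩
    have h1 := Complex.norm_mul_cos_arg ⟨a, b⟩
    have h2 := Complex.norm_mul_sin_arg ⟨a, b⟩
    rw [Complex.norm_eq_sqrt_sq_add_sq] at h1 h2
    exact ⟨h1, h2⟩
  set m := Real.sqrt (a ^ 2 + b ^ 2)
  have hrot : ∀ θ v, hamiltonian a b (θ, v) = hamiltonian m 0 (θ - θ₀, v) := by
    intro θ v
    simp only [hamiltonian]
    rw [Real.cos_sub, ← ha, ← hb]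
    ring
  ext s hs
  rw [Measure.map_apply (measurable_hamiltonian _ _) hs,
    Measure.map_apply (measurable_hamiltonian _ _) hs, phaseMeasure,
    Measure.prod_apply (measurable_hamiltonian _ _ hs),
    Measure.prod_apply (measurable_hamiltonian _ _ hs)]
  rw [← setLIntegral_periodic_sub (h := fun θ =>
    volume (Prod.mk θ ⁻¹' (hamiltonian m 0 ⁻¹' s))) ?_ θ₀]
  · refine lintegral_congr fun θ => ?_
    congr 1
    ext v
    simp only [Set.mem_preimage, hrot]
  · intro θ
    simp only [← Set.preimage_comp]
    congr 2
    ext v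
    simp [hamiltonian]

lemma sublevel_hamiltonian_eq (a b e : ℝ) :
    phaseMeasure {x | hamiltonian a b x < e}
      = phaseMeasure {x | hamiltonian (Real.sqrt (a ^ 2 + b ^ 2)) 0 x < e} := by
  have h := congrArg (fun ν => ν (Set.Iio e)) (map_hamiltonian_eq a b)
  simp only [Measure.map_apply (measurable_hamiltonian _ _) measurableSet_Iio] at h
  exact h

/-- The rank is a function of the energy alone, so the integral depends only on the law of the
energy. -/
lemma integral_rotate (a b : ℝ) {h : ℝ → ℝ → ℝ} (hh : Measurable (Function.uncurry h)) :
    ∫ x, h (hamiltonian a b x) (levelRank phaseMeasure (hamiltonian a b) x) ∂phaseMeasure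
      = ∫ x, h (hamiltonian (Real.sqrt (a ^ 2 + b ^ 2)) 0 x)
          (levelRank phaseMeasure (hamiltonian (Real.sqrt (a ^ 2 + b ^ 2)) 0) x)
          ∂phaseMeasure := by
  have hA : Measurable fun e => (phaseMeasure {x | hamiltonian a b x < e}).toReal := by
    have : Monotone fun e => phaseMeasure {x | hamiltonian a b x < e} :=
      fun _ _ h => sublevel_mono h
    exact this.measurable.ennreal_toReal
  have hk : Measurable fun e => h e (phaseMeasure {x | hamiltonian a b x < e}).toReal :=
    hh.comp (measurable_id.prodMk hA)
  have h1 := integral_map (measurable_hamiltonian a b).aemeasurable (μ := phaseMeasure)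
    hk.aestronglyMeasurable
  have h2 := integral_map
    (measurable_hamiltonian (Real.sqrt (a ^ 2 + b ^ 2)) 0).aemeasurable (μ := phaseMeasure)
    hk.aestronglyMeasurable
  rw [map_hamiltonian_eq a b, h2] at h1
  simp only [sublevel_hamiltonian_eq a b] at h1
  simp only [levelRank, sublevel_hamiltonian_eq a b]
  exact h1.symm

/-! ### The energy functional -/

section Energy

variable {f : ℝ × ℝ → ℝ}

lemma InEnergySpace.integrable (hf : InEnergySpace f) : Integrable f phaseMeasure := by
  have h := Integrable.bdd_mul (c := 1) (f := fun x : ℝ × ℝ => (1 + x.2 ^ 2)⁻¹) hf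
    (by fun_prop) (ae_of_all _ fun x => ?_)
  · refine h.congr (ae_of_all _ fun x => ?_)
    have : (1 + x.2 ^ 2) ≠ 0 := by positivity
    simp only
    field_simp
  · rw [Real.norm_of_nonneg (by positivity)]
    exact inv_le_one_of_one_le₀ (by linarith [sq_nonneg x.2])

lemma InEnergySpace.integrable_sq_mul (hf : InEnergySpace f) :
    Integrable (fun x => x.2 ^ 2 * f x) phaseMeasure := by
  refine (Integrable.sub hf hf.integrable).congr (ae_of_all _ fun x => ?_)
  simp only [Pi.sub_apply]
  ring

lemma integrable_fst_mul (hf : Integrable f phaseMeasure) {c : ℝ → ℝ} (hc : Measurable c)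
    {C : ℝ} (hC : ∀ θ, |c θ| ≤ C) : Integrable (fun x => c x.1 * f x) phaseMeasure :=
  hf.bdd_mul (hc.comp measurable_fst).aestronglyMeasurable (ae_of_all _ fun x => hC x.1)

lemma intervalIntegrable_density_mul (hf : Integrable f phaseMeasure) {c : ℝ → ℝ}
    (hc : Measurable c) {C : ℝ} (hC : ∀ θ, |c θ| ≤ C) :
    IntervalIntegrable (fun θ => density f θ * c θ) volume 0 (2 * Real.pi) := by
  rw [intervalIntegrable_iff_integrableOn_Ioc_of_le Real.two_pi_pos.le]
  refine (integrable_fst_mul hf hc hC).integral_prod_left.congr (ae_of_all _ fun θ => ?_)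
  simp only [density]
  rw [integral_const_mul, mul_comm]

lemma integral_density_mul (hf : Integrable f phaseMeasure) {c : ℝ → ℝ}
    (hc : Measurable c) {C : ℝ} (hC : ∀ θ, |c θ| ≤ C) :
    ∫ θ in (0 : ℝ)..(2 * Real.pi), density f θ * c θ = ∫ x, c x.1 * f x ∂phaseMeasure := by
  rw [intervalIntegral.integral_of_le Real.two_pi_pos.le, phaseMeasure,
    integral_prod _ (integrable_fst_mul hf hc hC)]
  refine integral_congr_ae (ae_of_all _ fun θ => ?_)
  simp only [density]
  rw [integral_const_mul, mul_comm]

lemma potential_eq (hf : Integrable f phaseMeasure) (θ : ℝ) :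
    potential f θ = -(magnetization f 0 * Real.cos θ + magnetization f 1 * Real.sin θ) := by
  have h1 := intervalIntegrable_density_mul hf Real.measurable_cos Real.abs_cos_le_one
  have h2 := intervalIntegrable_density_mul hf Real.measurable_sin Real.abs_sin_le_one
  simp only [potential, magnetization, PiLp.toLp_apply, Matrix.cons_val_zero, Matrix.cons_val_one]
  rw [← intervalIntegral.integral_mul_const, ← intervalIntegral.integral_mul_const,
    ← intervalIntegral.integral_add (h1.mul_const _) (h2.mul_const _)]
  congr 1
  refine intervalIntegral.integral_congr fun θ' _ => ?_
  simp only [Real.cos_sub]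
  ring

lemma norm_magnetization (f : ℝ × ℝ → ℝ) :
    ‖magnetization f‖ = Real.sqrt (magnetization f 0 ^ 2 + magnetization f 1 ^ 2) := by
  rw [EuclideanSpace.norm_eq, Fin.sum_univ_two, Real.norm_eq_abs, Real.norm_eq_abs, sq_abs, sq_abs]

/-- The energy of a particle in the field generated by `f`. -/
def meanField (f : ℝ × ℝ → ℝ) : ℝ × ℝ → ℝ := hamiltonian (magnetization f 0) (magnetization f 1)

lemma integral_field_mul (hf : Integrable f phaseMeasure) :
    ∫ x : ℝ × ℝ, (magnetization f 0 * Real.cos x.1 + magnetization f 1 * Real.sin x.1) * f x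
      ∂phaseMeasure = ‖magnetization f‖ ^ 2 := by
  have h1 := integral_density_mul hf Real.measurable_cos Real.abs_cos_le_one
  have h2 := integral_density_mul hf Real.measurable_sin Real.abs_sin_le_one
  have i1 := integrable_fst_mul hf Real.measurable_cos Real.abs_cos_le_one
  have i2 := integrable_fst_mul hf Real.measurable_sin Real.abs_sin_le_one
  have e0 : magnetization f 0 = ∫ x, Real.cos x.1 * f x ∂phaseMeasure := h1
  have e1 : magnetization f 1 = ∫ x, Real.sin x.1 * f x ∂phaseMeasure := h2
  simp only [add_mul, mul_assoc]
  rw [integral_add (i1.const_mul _) (i2.const_mul _), integral_const_mul, integral_const_mul,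
    ← e0, ← e1, norm_magnetization, Real.sq_sqrt (by positivity)]
  ring

lemma integrable_field_mul (hf : Integrable f phaseMeasure) :
    Integrable (fun x : ℝ × ℝ => (magnetization f 0 * Real.cos x.1
      + magnetization f 1 * Real.sin x.1) * f x) phaseMeasure :=
  integrable_fst_mul (c := fun θ => magnetization f 0 * Real.cos θ + magnetization f 1 * Real.sin θ)
    hf (by fun_prop) (abs_cos_add_sin_le _ _)

lemma integrable_meanField_mul (hf : InEnergySpace f) :
    Integrable (fun x => meanField f x * f x) phaseMeasure := by
  refine ((hf.integrable_sq_mul.const_mul (1 / 2)).sub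
    (integrable_field_mul hf.integrable)).congr (ae_of_all _ fun x => ?_)
  simp only [Pi.sub_apply, meanField, hamiltonian]
  ring

/-- The mean-field integral counts the interaction `-|M_f|²` in full, whereas the energy contains
half of it; `|M_f|²/2` restores the difference. -/
lemma energy_eq (hf : InEnergySpace f) :
    energy f = ‖magnetization f‖ ^ 2 / 2 + ∫ x, meanField f x * f x ∂phaseMeasure := by
  have h1 : ∫ x, meanField f x * f x ∂phaseMeasure
      = 1 / 2 * ∫ x, x.2 ^ 2 * f x ∂phaseMeasure - ‖magnetization f‖ ^ 2 := by
    rw [← integral_field_mul hf.integrable, ← integral_const_mul,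
      ← integral_sub (hf.integrable_sq_mul.const_mul _) (integrable_field_mul hf.integrable)]
    refine integral_congr_ae (ae_of_all _ fun x => ?_)
    simp only [meanField, hamiltonian]
    ring
  have h2 : ∫ θ in (0 : ℝ)..(2 * Real.pi), density f θ * potential f θ
      = -‖magnetization f‖ ^ 2 := by
    rw [← integral_field_mul hf.integrable]
    simp only [potential_eq hf.integrable, mul_neg, intervalIntegral.integral_neg]
    rw [integral_density_mul (c := fun θ => magnetization f 0 * Real.cos θ
      + magnetization f 1 * Real.sin θ) hf.integrable (by fun_prop) (abs_cos_add_sin_le _ _)]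
  rw [energy, h1, h2]
  ring

/-- Integrating `f` against its own field gives `|M_f|² ≤ |M_f| ‖f‖_{L¹}`; divide by `|M_f|`. -/
lemma norm_magnetization_le (hf : Integrable f phaseMeasure) : ‖magnetization f‖ ≤ normL1 f := by
  rcases (norm_nonneg (magnetization f)).eq_or_lt with h | h
  · rw [← h]
    exact integral_nonneg fun x => abs_nonneg _
  · refine le_of_mul_le_mul_left ?_ h
    rw [← sq, ← integral_field_mul hf, normL1, ← integral_const_mul]
    refine integral_mono (integrable_field_mul hf) (hf.abs.const_mul _) fun x => ?_
    refine (le_abs_self _).trans ?_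
    rw [abs_mul, norm_magnetization]
    exact mul_le_mul_of_nonneg_right (abs_cos_add_sin_le _ _ _) (abs_nonneg _)

/-! ### Integrability of the rearrangements -/

lemma integrableOn_sharpReal (hf : Integrable f phaseMeasure) (hf0 : 0 ≤ᵐ[phaseMeasure] f) :
    IntegrableOn (sharpReal f) (Set.Ioi 0) :=
  ((isLevelFunction_hamiltonian 0 0).integrable_comp_iff (measurable_sharpReal f)).1
    ((isLevelFunction_hamiltonian 0 0).integrable_rearrangement hf hf0)

/-- Rearranging along the kinetic energy lowers the integral of `rank²`, and there `rank ≤ 4π|v|`.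
-/
lemma integrableOn_sq_mul_sharpReal (hf : InEnergySpace f) (hf0 : 0 ≤ᵐ[phaseMeasure] f) :
    IntegrableOn (fun s => s ^ 2 * sharpReal f s) (Set.Ioi 0) := by
  have hg := isLevelFunction_hamiltonian 0 0
  have hmeas : Measurable fun s => s ^ 2 * sharpReal f s :=
    (measurable_id.pow_const 2).mul (measurable_sharpReal f)
  have hcomp : AEStronglyMeasurable (fun x => levelRank phaseMeasure (hamiltonian 0 0) x ^ 2
      * sharpReal f (levelRank phaseMeasure (hamiltonian 0 0) x)) phaseMeasure :=
    (hmeas.comp hg.measurable_levelRank).aestronglyMeasurable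
  rw [← hg.integrable_comp_iff hmeas, ← lintegral_ofReal_ne_top_iff_integrable hcomp
    (ae_of_all _ fun x => mul_nonneg (sq_nonneg _) (sharpReal_nonneg _ _))]
  simp_rw [ENNReal.ofReal_mul (sq_nonneg _)]
  have hi : Integrable (fun x => (4 * Real.pi) ^ 2 * (x.2 ^ 2 * f x)) phaseMeasure :=
    hf.integrable_sq_mul.const_mul _
  have hi0 : 0 ≤ᵐ[phaseMeasure] fun x => (4 * Real.pi) ^ 2 * (x.2 ^ 2 * f x) := by
    filter_upwards [hf0] with x hx
    exact mul_nonneg (sq_nonneg _) (mul_nonneg (sq_nonneg _) hx)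
  refine ne_top_of_le_ne_top
    ((lintegral_ofReal_ne_top_iff_integrable hi.aestronglyMeasurable hi0).2 hi)
    ((hg.lintegral_rearrangement_le hf.integrable hf0
      (hg.measurable_levelRank.pow_const 2).ennreal_ofReal fun x y h =>
        ENNReal.ofReal_le_ofReal (pow_le_pow_left₀ (levelRank_nonneg _) (hg.levelRank_mono h) 2)).trans
      (lintegral_mono fun x => ?_))
  have h1 : levelRank phaseMeasure (hamiltonian 0 0) x ^ 2 ≤ (4 * Real.pi) ^ 2 * x.2 ^ 2 := by
    rw [← sq_abs x.2, ← mul_pow]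
    exact pow_le_pow_left₀ (levelRank_nonneg _) (levelRank_kinetic_le x) 2
  rw [← mul_assoc, ENNReal.ofReal_mul (by positivity)]
  gcongr

lemma integrable_hamiltonian_mul_rearrangement (a b : ℝ) (hf : InEnergySpace f)
    (hf0 : 0 ≤ᵐ[phaseMeasure] f) :
    Integrable (fun x => hamiltonian a b x
      * sharpReal f (levelRank phaseMeasure (hamiltonian a b) x)) phaseMeasure := by
  have hg := isLevelFunction_hamiltonian a b
  have h1 := (hg.integrable_comp_iff
    ((measurable_id.pow_const 2).mul (measurable_sharpReal f))).2
    (integrableOn_sq_mul_sharpReal hf hf0)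
  refine Integrable.mono' (((hg.integrable_rearrangement hf.integrable hf0).const_mul
    (Real.sqrt (a ^ 2 + b ^ 2))).add h1)
    ((measurable_hamiltonian a b).mul hg.measurable_rearrangement).aestronglyMeasurable
    (ae_of_all _ fun x => ?_)
  rw [norm_mul, Real.norm_eq_abs, Real.norm_of_nonneg (sharpReal_nonneg _ _)]
  simp only [Pi.add_apply, Pi.mul_apply, id]
  rw [← add_mul]
  refine mul_le_mul_of_nonneg_right (abs_le.2 ⟨?_, hamiltonian_le_rank a b x⟩)
    (sharpReal_nonneg _ _)
  have := neg_sqrt_le_hamiltonian a b x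
  nlinarith [sq_nonneg (levelRank phaseMeasure (hamiltonian a b) x)]

/-! ### Expressing the rearrangements and the reduced energy through ranks -/

lemma rearrangement_eq (f : ℝ × ℝ → ℝ) (x : ℝ × ℝ) :
    rearrangement f x
      = sharpReal f (levelRank phaseMeasure (fun x => Real.sqrt (x.1 ^ 2 + x.2 ^ 2)) x) := by
  rw [sharpReal, isLevelFunction_radius.ofReal_levelRank, rearrangement]

lemma reducedIntegrand_eq (f : ℝ × ℝ → ℝ) (m : ℝ) (x : ℝ × ℝ) :
    reducedIntegrand f m x = hamiltonian m 0 x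
      * sharpReal f (levelRank phaseMeasure (hamiltonian m 0) x) := by
  have h : ∀ y : ℝ × ℝ, y.2 ^ 2 / 2 + cosPotential m y.1 = hamiltonian m 0 y := fun y => by
    simp only [cosPotential, hamiltonian]
    ring
  rw [sharpReal, (isLevelFunction_hamiltonian m 0).ofReal_levelRank, reducedIntegrand,
    energyRearrangement, sublevelVolume]
  simp only [h]

lemma reducedEnergy_norm_magnetization (f f₀ : ℝ × ℝ → ℝ) :
    reducedEnergy f₀ ‖magnetization f‖ = ‖magnetization f‖ ^ 2 / 2
      + ∫ x, meanField f x * sharpReal f₀ (levelRank phaseMeasure (meanField f) x)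
        ∂phaseMeasure := by
  have h := integral_rotate (magnetization f 0) (magnetization f 1)
    (h := fun e s => e * sharpReal f₀ s)
    (measurable_fst.mul ((measurable_sharpReal f₀).comp measurable_snd))
  rw [← norm_magnetization] at h
  simp only [reducedEnergy, reducedIntegrand_eq, meanField]
  rw [h]

lemma integrable_rearrangement_sub {f₀ : ℝ × ℝ → ℝ} (hf : Integrable f phaseMeasure)
    (hf0 : 0 ≤ᵐ[phaseMeasure] f) (hf₀ : Integrable f₀ phaseMeasure)
    (hf₀0 : 0 ≤ᵐ[phaseMeasure] f₀) :
    Integrable (fun x => rearrangement f x - rearrangement f₀ x) phaseMeasure := by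
  simp only [rearrangement_eq]
  exact (isLevelFunction_radius.integrable_rearrangement hf hf0).sub
    (isLevelFunction_radius.integrable_rearrangement hf₀ hf₀0)

lemma normL1_rearrangement_sub (f f₀ : ℝ × ℝ → ℝ) :
    normL1 (fun x => rearrangement f x - rearrangement f₀ x)
      = ∫ s in Set.Ioi (0 : ℝ), |sharpReal f s - sharpReal f₀ s| := by
  simp only [normL1, rearrangement_eq]
  exact isLevelFunction_radius.integral_comp (h := fun s => |sharpReal f s - sharpReal f₀ s|)
    ((measurable_sharpReal f).sub (measurable_sharpReal f₀)).abs

lemma integrableOn_sq_mul_posPart {f₀ : ℝ × ℝ → ℝ} (hf₀ : InEnergySpace f₀)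
    (hf₀0 : 0 ≤ᵐ[phaseMeasure] f₀) :
    IntegrableOn (fun s : ℝ => s ^ 2 * max (sharpReal f₀ s - sharpReal f s) 0) (Set.Ioi 0) := by
  refine Integrable.mono' (integrableOn_sq_mul_sharpReal hf₀ hf₀0)
    ((measurable_id.pow_const 2).mul (((measurable_sharpReal f₀).sub
      (measurable_sharpReal f)).max measurable_const)).aestronglyMeasurable
    (ae_of_all _ fun s => ?_)
  rw [Real.norm_of_nonneg (mul_nonneg (sq_nonneg _) (le_max_right _ _))]
  refine mul_le_mul_of_nonneg_left (max_le ?_ (sharpReal_nonneg _ _)) (sq_nonneg _)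
  linarith [sharpReal_nonneg f s]

/-- Comparison of the energies of two rearrangements along the same Hamiltonian. -/
lemma integral_hamiltonian_mul_sub_le (a b : ℝ) {f₀ : ℝ × ℝ → ℝ} (hf : InEnergySpace f)
    (hf0 : 0 ≤ᵐ[phaseMeasure] f) (hf₀ : InEnergySpace f₀) (hf₀0 : 0 ≤ᵐ[phaseMeasure] f₀) :
    ∫ x, hamiltonian a b x * sharpReal f₀ (levelRank phaseMeasure (hamiltonian a b) x)
        ∂phaseMeasure
      - ∫ x, hamiltonian a b x * sharpReal f (levelRank phaseMeasure (hamiltonian a b) x)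
        ∂phaseMeasure
      ≤ Real.sqrt (a ^ 2 + b ^ 2) * (∫ s in Set.Ioi (0 : ℝ), |sharpReal f s - sharpReal f₀ s|)
        + ∫ s in Set.Ioi (0 : ℝ), s ^ 2 * max (sharpReal f₀ s - sharpReal f s) 0 := by
  set m := Real.sqrt (a ^ 2 + b ^ 2) with hm
  have hg := isLevelFunction_hamiltonian a b
  set k : ℝ → ℝ := fun s => m * |sharpReal f s - sharpReal f₀ s|
    + s ^ 2 * max (sharpReal f₀ s - sharpReal f s) 0 with hk
  have i1 : IntegrableOn (fun s => m * |sharpReal f s - sharpReal f₀ s|) (Set.Ioi 0) :=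
    ((integrableOn_sharpReal hf.integrable hf0).sub
      (integrableOn_sharpReal hf₀.integrable hf₀0)).abs.const_mul m
  have i2 := integrableOn_sq_mul_posPart (f := f) hf₀ hf₀0
  have hkm : Measurable k := by
    have h1 := measurable_sharpReal f
    have h2 := measurable_sharpReal f₀
    exact ((h1.sub h2).abs.const_mul m).add
      ((measurable_id.pow_const 2).mul ((h2.sub h1).max measurable_const))
  have j₀ := integrable_hamiltonian_mul_rearrangement a b hf₀ hf₀0
  have j := integrable_hamiltonian_mul_rearrangement a b hf hf0
  rw [← integral_sub j₀ j, ← integral_const_mul, ← integral_add i1 i2]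
  rw [← hg.integral_comp hkm]
  refine integral_mono (j₀.sub j) ((hg.integrable_comp_iff hkm).2 (i1.add i2)) fun x => ?_
  have h1 := hamiltonian_le_rank a b x
  have h2 := neg_sqrt_le_hamiltonian a b x
  rw [← hm] at h1 h2
  simp only [hk]
  rw [← mul_sub, abs_sub_comm]
  generalize levelRank phaseMeasure (hamiltonian a b) x = s at h1
  -- Where `f₀^♯ ≥ f^♯` the upper bound `m + s²` on the energy is used; elsewhere the lower bound
  -- `-m` suffices.
  rcases le_total 0 (sharpReal f₀ s - sharpReal f s) with h | h
  · rw [abs_of_nonneg h, max_eq_left h, ← add_mul]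
    exact mul_le_mul_of_nonneg_right h1 h
  · rw [abs_of_nonpos h, max_eq_right h]
    nlinarith

end Energy

/-! ### The steady state -/

section SteadyState

variable {F : ℝ → ℝ} {eStar : WithTop ℝ} {m₀ : ℝ}

lemma IsSteadyProfile.antitone_and_nonneg (hF : IsSteadyProfile F eStar m₀) :
    Antitone F ∧ ∀ e, 0 ≤ F e := by
  have hd : ∀ e : ℝ, (e : WithTop ℝ) < eStar → DifferentiableAt ℝ F e := fun e he =>
    differentiableAt_of_deriv_ne_zero (hF.deriv_neg e he).ne
  induction eStar using WithTop.recTopCoe with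
  | top =>
    have h : Antitone F := antitone_of_deriv_nonpos (fun e => hd e (WithTop.coe_lt_top e))
      fun e => (hF.deriv_neg e (WithTop.coe_lt_top e)).le
    exact ⟨h, fun e => h.le_of_tendsto (hF.tendsto_zero rfl) e⟩
  | coe c =>
    have h : AntitoneOn F (Set.Iic c) := by
      refine antitoneOn_of_deriv_nonpos (convex_Iic c) hF.continuous.continuousOn ?_ ?_ <;>
        rw [interior_Iic]
      · exact fun e he => (hd e (WithTop.coe_lt_coe.2 he)).differentiableWithinAt
      · exact fun e he => (hF.deriv_neg e (WithTop.coe_lt_coe.2 he)).le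
    have hz : ∀ e, c ≤ e → F e = 0 := fun e he => hF.eq_zero e (WithTop.coe_le_coe.2 he)
    have h0 : ∀ e, 0 ≤ F e := fun e => by
      rcases le_total e c with he | he
      · exact (hz c le_rfl).symm.le.trans (h he Set.self_mem_Iic he)
      · exact (hz e he).symm.le
    refine ⟨fun x y hxy => ?_, h0⟩
    rcases le_total y c with hy | hy
    · exact h (hxy.trans hy) hy hxy
    · rw [hz y hy]
      exact h0 x

lemma steadyState_eq (F : ℝ → ℝ) (m₀ : ℝ) :
    steadyState F m₀ = fun x => F (hamiltonian m₀ 0 x) := by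
  ext x
  simp only [steadyState, cosPotential, hamiltonian]
  congr 1
  ring

/-- Self-consistency at `θ = 0` and `θ = π/2` reads off both components of the magnetization: `(m₀,
0)`. -/
lemma IsSteadyProfile.meanField_eq (hF : IsSteadyProfile F eStar m₀) :
    meanField (steadyState F m₀) = hamiltonian m₀ 0 := by
  have h0 := hF.selfConsistent 0
  have h1 := hF.selfConsistent (Real.pi / 2)
  rw [potential_eq hF.inEnergySpace.integrable] at h0 h1
  simp only [cosPotential, Real.cos_zero, Real.sin_zero, Real.cos_pi_div_two,
    Real.sin_pi_div_two, mul_zero, mul_one, add_zero, zero_add, neg_inj, neg_eq_zero] at h0 h1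
  rw [meanField, h0, h1]

lemma IsSteadyProfile.energy_le_reducedEnergy (hF : IsSteadyProfile F eStar m₀) :
    energy (steadyState F m₀)
      ≤ reducedEnergy (steadyState F m₀) ‖magnetization (steadyState F m₀)‖ := by
  obtain ⟨hanti, hnn⟩ := hF.antitone_and_nonneg
  have hE := hF.inEnergySpace
  have hi := integrable_meanField_mul hE
  rw [energy_eq hE, reducedEnergy_norm_magnetization]
  refine add_le_add le_rfl ?_
  rw [hF.meanField_eq] at hi ⊢
  rw [steadyState_eq] at hE hi ⊢
  exact (isLevelFunction_hamiltonian m₀ 0).integral_mul_le_rearrangement hanti hnn hE.integrable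
    (neg_sqrt_le_hamiltonian m₀ 0) hi
    (integrable_hamiltonian_mul_rearrangement m₀ 0 hE (ae_of_all _ fun x => hnn _))

end SteadyState

end

end HMF

/-! ### Assembling the inequality -/

theorem mainTheorem5 (F : ℝ → ℝ) (eStar : WithTop ℝ) (m₀ : ℝ)
    (hF : HMF.IsSteadyProfile F eStar m₀)
    (f : ℝ × ℝ → ℝ) (hf_nonneg : 0 ≤ᵐ[HMF.phaseMeasure] f) (hf : HMF.InEnergySpace f) :
    -- every integral in the inequality converges
    (∀ m : ℝ, 0 ≤ m →
      Integrable (HMF.reducedIntegrand (HMF.steadyState F m₀) m) HMF.phaseMeasure) ∧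
    Integrable (fun x => HMF.rearrangement f x
      - HMF.rearrangement (HMF.steadyState F m₀) x) HMF.phaseMeasure ∧
    IntegrableOn (fun s : ℝ => s ^ 2 *
      max (HMF.sharpReal (HMF.steadyState F m₀) s - HMF.sharpReal f s) 0) (Set.Ioi 0) ∧
    -- the inequality
    HMF.reducedEnergy (HMF.steadyState F m₀) ‖HMF.magnetization f‖
        - HMF.reducedEnergy (HMF.steadyState F m₀) ‖HMF.magnetization (HMF.steadyState F m₀)‖
      ≤ HMF.energy f - HMF.energy (HMF.steadyState F m₀)
        + (2 * m₀ + 3 * HMF.normL1 f)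
          * HMF.normL1 (fun x => HMF.rearrangement f x
              - HMF.rearrangement (HMF.steadyState F m₀) x)
        + ∫ s in Set.Ioi (0 : ℝ), s ^ 2 *
            max (HMF.sharpReal (HMF.steadyState F m₀) s - HMF.sharpReal f s) 0 := by
  have hE := hF.inEnergySpace
  have hn : 0 ≤ᵐ[HMF.phaseMeasure] HMF.steadyState F m₀ :=
    ae_of_all _ fun x => hF.antitone_and_nonneg.2 _
  refine ⟨fun m _ => ?_,
    HMF.integrable_rearrangement_sub hf.integrable hf_nonneg hE.integrable hn,
    HMF.integrableOn_sq_mul_posPart hE hn, ?_⟩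
  · simp only [funext (HMF.reducedIntegrand_eq (HMF.steadyState F m₀) m)]
    exact HMF.integrable_hamiltonian_mul_rearrangement m 0 hE hn
  · have h1 := hF.energy_le_reducedEnergy
    have h2 := HMF.integral_hamiltonian_mul_sub_le (HMF.magnetization f 0)
      (HMF.magnetization f 1) hf hf_nonneg hE hn
    have h3 := (HMF.isLevelFunction_hamiltonian (HMF.magnetization f 0)
      (HMF.magnetization f 1)).integral_mul_rearrangement_le hf.integrable hf_nonneg
      (HMF.neg_sqrt_le_hamiltonian _ _) (HMF.integrable_meanField_mul hf)
      (HMF.integrable_hamiltonian_mul_rearrangement _ _ hf hf_nonneg)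
    have h4 := HMF.norm_magnetization_le hf.integrable
    rw [← HMF.normL1_rearrangement_sub, ← HMF.norm_magnetization] at h2
    -- The argument yields the factor `|M_f| ≤ ‖f‖_{L¹}`, which is then enlarged to the stated
    -- constant.
    have h5 : ‖HMF.magnetization f‖ ≤ 2 * m₀ + 3 * HMF.normL1 f := by
      linarith [hF.m₀_pos, norm_nonneg (HMF.magnetization f)]
    have h6 : 0 ≤ HMF.normL1 (fun x => HMF.rearrangement f x
        - HMF.rearrangement (HMF.steadyState F m₀) x) := integral_nonneg fun x => abs_nonneg _
    have h7 := mul_le_mul_of_nonneg_right h5 h6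
    rw [HMF.energy_eq hf, HMF.reducedEnergy_norm_magnetization f]
    simp only [HMF.meanField] at *
    linarith
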